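/- Let $\mathcal A$ be an exact category in the sense of Quillen, with $\operatorname{Hom}_{\mathcal A}(X,Y)$ finite for all objects $X,Y$. Write $\operatorname{Iso}\mathcal A$ for the set of isomorphism classes of objects, an abelian monoid under $[X]+[Y]=[X\oplus Y]$, and let $\underline{\operatorname{Ext}}^1(A,B)\subset\operatorname{Iso}\mathcal A$ be the set of classes $[X]$ such that there is a short exact sequence $B\rightarrowtail X\twoheadrightarrow A$. The Grothendieck monoid $\Gamma_{\mathcal A}$ is the quotient of $\operatorname{Iso}\mathcal A$ by the congruence that is the transitive closure of the relation: $[X]\equiv[Y]$ if $[X],[Y]\in\underline{\operatorname{Ext}}^1(M,N)$ for some objects $M,N$. Let $|X|$ be the image of $[X]$ in $\Gamma_{\mathcal A}$, let $\Gamma_{\mathcal A}^+=\Gamma_{\mathcal A}\setminus\{0\}$, let $\operatorname{Iso}\mathcal A_\gamma=\{[X]: |X|=\gamma\}$, and let $\operatorname{Ind}\mathcal A_\gamma$ be the set of classes of indecomposable objects in $\operatorname{Iso}\mathcal A_\gamma$. Assume that $\mathcal A$ is profinitary (every $\operatorname{Iso}\mathcal A_\gamma$ is finite) and cofinitary (for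 every $[X]$ the set of pairs $([A],[B])$ with $[X]\in\underline{\operatorname{Ext}}^1(A,B)$ is finite). Let $H_{\mathcal A}=\bigoplus_{[X]\in\operatorname{Iso}\mathcal A}\mathbb Q\,[X]$ with product $$[A]\cdot[B]=\sum_{[C]}F_{A,B}^C\,[C],$$ where $F_{A,B}^C$ is the number of $\operatorname{Aut}A\times\operatorname{Aut}B$-orbits on the set of short exact sequences $B\rightarrowtail C\twoheadrightarrow A$, with unit $1=[0]$, coproduct $$\Delta([C])=\sum_{[A],[B]}F^{A,B}_C\,[A]\otimes[B],\qquad F^{A,B}_C=\frac{\#(\operatorname{Aut}A\times\operatorname{Aut}B)}{\#\operatorname{Aut}C}\,F_{B,A}^C,$$ and counit $\varepsilon([C])=\delta_{[0],[C]}$. For $\gamma\in\Gamma_{\mathcal A}$ put $(H_{\mathcal A})_\gamma=\mathbb Q\operatorname{Iso}\mathcal A_\gamma$. Let $\operatorname{Prim}(H_{\mathcal A})=\{c\in H_{\mathcal A}:\Delta(c)=c\otimes1+1\otimes c\}$ and $\operatorname{Prim}(H_{\mathcal A})_\gamma=\operatorname{Prim}(H_{\mathcal A})\cap(H_{\mathcal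 A})_\gamma$. Let $P=\ker\varepsilon\cdot\ker\varepsilon$ be the linear span of all products of two elements of $\ker\varepsilon$, and $P_\gamma=P\cap(H_{\mathcal A})_\gamma$. Then for every $\gamma\in\Gamma_{\mathcal A}^+$ the set $\operatorname{Ind}\mathcal A_\gamma$ is finite, the space $(H_{\mathcal A})_\gamma$ is finite dimensional, and the multiplicity $m_\gamma:=\#\operatorname{Ind}\mathcal A_\gamma-\dim_{\mathbb Q}\operatorname{Prim}(H_{\mathcal A})_\gamma$ satisfies $$m_\gamma=\dim_{\mathbb Q}\bigl(P_\gamma\cap\mathbb Q\operatorname{Ind}\mathcal A_\gamma\bigr).$$ In particular $m_\gamma\ge0$, and $\operatorname{Prim}(H_{\mathcal A})_\gamma=0$ whenever $\operatorname{Ind}\mathcal A_\gamma\subset P_\gamma$. -/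

import Mathlib

open CategoryTheory CategoryTheory.Limits
open scoped TensorProduct ZeroObject

universe v u

namespace HallAlgebra

section Basic

variable {C : Type u} [Category.{v} C] [Preadditive C]

/-- `f` is an admissible monomorphism for a class `𝓔` of short complexes: it is the first map of
a member of `𝓔`. -/
def IsInflation (𝓔 : ShortComplex C → Prop) {X Y : C} (f : X ⟶ Y) : Prop :=
  ∃ (Z : C) (g : Y ⟶ Z) (w : f ≫ g = 0), 𝓔 (ShortComplex.mk f g w)

/-- `g` is an admissible epimorphism for a class `𝓔` of short complexes: it is the second map of
a member of `𝓔`. -/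
def IsDeflation (𝓔 : ShortComplex C → Prop) {Y Z : C} (g : Y ⟶ Z) : Prop :=
  ∃ (X : C) (f : X ⟶ Y) (w : f ≫ g = 0), 𝓔 (ShortComplex.mk f g w)

end Basic

/-- A Quillen exact structure on an additive category: a class of kernel-cokernel pairs, closed
under isomorphism, whose members are called short exact sequences, subject to the usual axioms. -/
structure ExactStructure (C : Type u) [Category.{v} C] [Preadditive C] [HasZeroObject C]
    [HasBinaryBiproducts C] where
  /-- the short exact sequences -/
  Exact : ShortComplex C → Prop
  of_iso : ∀ {S T : ShortComplex C}, (S ≅ T) → Exact S → Exact T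
  isKernel : ∀ {S : ShortComplex C}, Exact S → Nonempty (IsLimit (KernelFork.ofι S.f S.zero))
  isCokernel : ∀ {S : ShortComplex C}, Exact S →
    Nonempty (IsColimit (CokernelCofork.ofπ S.g S.zero))
  inflation_id : ∀ X : C, IsInflation Exact (𝟙 X)
  deflation_id : ∀ X : C, IsDeflation Exact (𝟙 X)
  inflation_comp : ∀ {X Y Z : C} (f : X ⟶ Y) (g : Y ⟶ Z),
    IsInflation Exact f → IsInflation Exact g → IsInflation Exact (f ≫ g)
  deflation_comp : ∀ {X Y Z : C} (f : X ⟶ Y) (g : Y ⟶ Z),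
    IsDeflation Exact f → IsDeflation Exact g → IsDeflation Exact (f ≫ g)
  inflation_pushout : ∀ {X Y X' : C} (f : X ⟶ Y) (a : X ⟶ X'), IsInflation Exact f →
    ∃ (Y' : C) (b : Y ⟶ Y') (f' : X' ⟶ Y'), IsPushout f a b f' ∧ IsInflation Exact f'
  deflation_pullback : ∀ {Y Z Z' : C} (g : Y ⟶ Z) (c : Z' ⟶ Z), IsDeflation Exact g →
    ∃ (Y' : C) (b : Y' ⟶ Y) (g' : Y' ⟶ Z'), IsPullback b g' g c ∧ IsDeflation Exact g'

section IsoClasses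

/-- The set `Iso C` of isomorphism classes of objects. -/
def IsoClass (C : Type u) [Category.{v} C] : Type u := Quotient (isIsomorphicSetoid C)

/-- The isomorphism class `[X]`. -/
def IsoClass.mk {C : Type u} [Category.{v} C] (X : C) : IsoClass C :=
  Quotient.mk (isIsomorphicSetoid C) X

/-- A chosen representative of an isomorphism class. -/
noncomputable def IsoClass.rep {C : Type u} [Category.{v} C] (x : IsoClass C) : C :=
  Quotient.out (s := isIsomorphicSetoid C) x

theorem IsoClass.mk_rep {C : Type u} [Category.{v} C] (x : IsoClass C) :
    IsoClass.mk x.rep = x :=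
  Quotient.out_eq (s := isIsomorphicSetoid C) x

theorem IsoClass.mk_eq_iff {C : Type u} [Category.{v} C] {X Y : C} :
    IsoClass.mk X = IsoClass.mk Y ↔ Nonempty (X ≅ Y) :=
  Quotient.eq (r := isIsomorphicSetoid C)

theorem IsoClass.ind {C : Type u} [Category.{v} C] {p : IsoClass C → Prop}
    (h : ∀ X : C, p (IsoClass.mk X)) (x : IsoClass C) : p x :=
  Quotient.inductionOn (s := isIsomorphicSetoid C) x h

variable {C : Type u} [Category.{v} C] [Preadditive C] [HasZeroObject C] [HasBinaryBiproducts C]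

/-- `0 = [0]` -/
noncomputable instance IsoClass.instZero : Zero (IsoClass C) := ⟨IsoClass.mk (0 : C)⟩

/-- `[X] + [Y] = [X ⊕ Y]` -/
noncomputable instance IsoClass.instAdd : Add (IsoClass C) :=
  ⟨Quotient.map₂ (sa := isIsomorphicSetoid C) (sb := isIsomorphicSetoid C)
    (sc := isIsomorphicSetoid C) (fun X Y => X ⊞ Y)
    (fun _ _ ⟨e⟩ _ _ ⟨e'⟩ => ⟨biprod.mapIso e e'⟩)⟩

noncomputable instance IsoClass.instAddCommMonoid : AddCommMonoid (IsoClass C) where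
  add_assoc a b c := by
    induction a using IsoClass.ind with | h X
    induction b using IsoClass.ind with | h Y
    induction c using IsoClass.ind with | h Z
    exact IsoClass.mk_eq_iff.2 ⟨biprod.associator X Y Z⟩
  zero_add a := by
    induction a using IsoClass.ind with | h X
    exact IsoClass.mk_eq_iff.2 ⟨(isoZeroBiprod (isZero_zero C)).symm⟩
  add_zero a := by
    induction a using IsoClass.ind with | h X
    exact IsoClass.mk_eq_iff.2 ⟨(isoBiprodZero (isZero_zero C)).symm⟩
  add_comm a b := by
    induction a using IsoClass.ind with | h X
    induction b using IsoClass.ind with | h Y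
    exact IsoClass.mk_eq_iff.2 ⟨biprod.braiding X Y⟩
  nsmul := nsmulRec

end IsoClasses

namespace ExactStructure

variable {C : Type u} [Category.{v} C] [Preadditive C] [HasZeroObject C] [HasBinaryBiproducts C]

section Extensions

variable (E : ExactStructure C)

/-- If `g` is an admissible epimorphism then any kernel `f` of `g` makes `(f, g)` exact. -/
theorem exact_of_deflation {X Y Z : C} {f : X ⟶ Y} {g : Y ⟶ Z} (w : f ≫ g = 0)
    (hf : IsLimit (KernelFork.ofι f w)) (hg : IsDeflation E.Exact g) :
    E.Exact (ShortComplex.mk f g w) := by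
  obtain ⟨X', f', w', h'⟩ := hg
  obtain ⟨hf'⟩ := E.isKernel h'
  let e : X' ≅ X := IsLimit.conePointUniqueUpToIso hf' hf
  have he : e.hom ≫ f = f' :=
    IsLimit.conePointUniqueUpToIso_hom_comp hf' hf WalkingParallelPair.zero
  exact E.of_iso (S := ShortComplex.mk f' g w')
    (ShortComplex.isoMk e (Iso.refl _) (Iso.refl _) (by simp [he]) (by simp)) h'

theorem deflation_biprod_fst (X Z : C) : IsDeflation E.Exact (biprod.fst : X ⊞ Z ⟶ X) := by
  obtain ⟨Q, q, w, hq⟩ := E.inflation_id Z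
  have hQ : q = 0 := by simpa using w
  have hQ0 : IsZero Q := by
    obtain ⟨h⟩ := E.isCokernel hq
    refine (IsZero.iff_id_eq_zero _).2 (Cofork.IsColimit.hom_ext h ?_)
    simp [hQ]
  obtain ⟨Y, b, g, hp, K, f, w', hK⟩ :=
    E.deflation_pullback q (0 : X ⟶ Q) ⟨_, _, w, hq⟩
  have hp' : IsPullback (biprod.snd : X ⊞ Z ⟶ Z) (biprod.fst : X ⊞ Z ⟶ X) q (0 : X ⟶ Q) := by
    refine IsPullback.of_iso (IsPullback.of_has_biproduct X Z).flip (Iso.refl _) (Iso.refl _)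
      (Iso.refl _) ((isZero_zero C).iso hQ0) (by simp) (by simp) ?_ ?_
    · exact hQ0.eq_of_tgt _ _
    · exact hQ0.eq_of_tgt _ _
  let e : Y ≅ X ⊞ Z := hp.isoIsPullback _ _ hp'
  have he : e.hom ≫ biprod.fst = g := hp.isoIsPullback_hom_snd _ _ hp'
  have w2 : (f ≫ e.hom) ≫ (biprod.fst : X ⊞ Z ⟶ X) = 0 := by
    rw [Category.assoc, he, w']
  exact ⟨K, f ≫ e.hom, w2, E.of_iso (S := ShortComplex.mk f g w')
    (ShortComplex.isoMk (Iso.refl _) e (Iso.refl _) (by simp) (by simp [he])) hK⟩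

theorem exact_split (A B : C) :
    E.Exact (ShortComplex.mk (biprod.inr : B ⟶ A ⊞ B) (biprod.fst : A ⊞ B ⟶ A) (by simp)) :=
  E.exact_of_deflation _ (biprod.isKernelFstKernelFork A B) (E.deflation_biprod_fst A B)

theorem exact_biprod {S : ShortComplex C} (hS : E.Exact S) (Z : C) :
    E.Exact (ShortComplex.mk (biprod.map S.f (𝟙 Z)) (biprod.fst ≫ S.g) (by simp)) := by
  obtain ⟨hk⟩ := E.isKernel hS
  have hmono : Mono S.f := mono_of_isLimit_fork hk
  refine E.exact_of_deflation _ ?_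
    (E.deflation_comp _ _ (E.deflation_biprod_fst S.X₂ Z) ⟨_, S.f, S.zero, hS⟩)
  refine KernelFork.IsLimit.ofι _ _
    (fun k hk' => biprod.lift
      (KernelFork.IsLimit.lift' hk (k ≫ biprod.fst) (by simpa using hk')).1 (k ≫ biprod.snd))
    (fun k hk' => ?_) (fun k hk' m hm => ?_)
  · have := (KernelFork.IsLimit.lift' hk (k ≫ biprod.fst) (by simpa using hk')).2
    apply biprod.hom_ext
    · simpa using this
    · simp
  · have := (KernelFork.IsLimit.lift' hk (k ≫ biprod.fst) (by simpa using hk')).2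
    apply biprod.hom_ext
    · rw [← cancel_mono S.f]
      simp only [biprod.lift_fst]
      refine Eq.trans ?_ this.symm
      rw [← hm]; simp
    · have h := congrArg (fun t => t ≫ biprod.snd) hm
      simpa using h

/-- The set `Ext¹(a, b)` of all classes `[X]` for which there is a short exact sequence
`B ↣ X ↠ A` with `[A] = a` and `[B] = b`. -/
def ext (a b : IsoClass C) : Set (IsoClass C) :=
  {x | ∃ S : ShortComplex C, E.Exact S ∧ IsoClass.mk S.X₁ = b ∧ IsoClass.mk S.X₂ = x ∧
    IsoClass.mk S.X₃ = a}

theorem add_mem_ext (a b : IsoClass C) : a + b ∈ E.ext a b := by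
  induction a using IsoClass.ind with | h A
  induction b using IsoClass.ind with | h B
  exact ⟨_, E.exact_split A B, rfl, rfl, rfl⟩

/-- `[X] ≡ [Y]` when both lie in `Ext¹(M, N)` for some objects `M`, `N`. -/
def GrothendieckRel (x y : IsoClass C) : Prop :=
  ∃ a b : IsoClass C, x ∈ E.ext a b ∧ y ∈ E.ext a b

theorem GrothendieckRel.add_right {x y : IsoClass C} (h : E.GrothendieckRel x y)
    (z : IsoClass C) : E.GrothendieckRel (x + z) (y + z) := by
  obtain ⟨a, b, ⟨S, hS, rfl, rfl, rfl⟩, ⟨T, hT, hb, rfl, ha⟩⟩ := h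
  induction z using IsoClass.ind with | h Z
  refine ⟨IsoClass.mk S.X₃, IsoClass.mk S.X₁ + IsoClass.mk Z,
    ⟨_, E.exact_biprod hS Z, rfl, rfl, rfl⟩, ⟨_, E.exact_biprod hT Z, ?_, rfl, ha⟩⟩
  rw [← hb]; rfl

theorem eqvGen_add_right {x y : IsoClass C} (h : Relation.EqvGen E.GrothendieckRel x y)
    (z : IsoClass C) : Relation.EqvGen E.GrothendieckRel (x + z) (y + z) := by
  induction h with
  | rel x y h => exact .rel _ _ (h.add_right E z)
  | refl x => exact .refl _
  | symm x y _ ih => exact .symm _ _ ih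
  | trans x y w _ _ ih ih' => exact .trans _ _ _ ih ih'

/-- The equivalence relation generated by `≡`, which is a congruence on `Iso C`. -/
noncomputable def grothendieckCon : AddCon (IsoClass C) where
  toSetoid := Relation.EqvGen.setoid E.GrothendieckRel
  add' {x y z w} h h' := by
    refine .trans _ _ _ (E.eqvGen_add_right h z) ?_
    rw [add_comm y z, add_comm y w]
    exact E.eqvGen_add_right h' y

/-- The Grothendieck monoid `Γ`. -/
abbrev GrothendieckMonoid : Type u := E.grothendieckCon.Quotient

/-- The class `|X|` in the Grothendieck monoid of the isomorphism class `[X]`. -/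
noncomputable def grade (x : IsoClass C) : E.GrothendieckMonoid := E.grothendieckCon.mk' x

/-- The Grothendieck class `Iso C_γ`. -/
def isoGrade (γ : E.GrothendieckMonoid) : Set (IsoClass C) := {x | E.grade x = γ}

theorem grade_of_mem_ext {a b x : IsoClass C} (h : x ∈ E.ext a b) :
    E.grade x = E.grade (a + b) :=
  (AddCon.eq _).2 (.rel _ _ ⟨a, b, h, E.add_mem_ext a b⟩)

/-- All morphism groups are finite. -/
def HomFinite (_E : ExactStructure C) : Prop := ∀ X Y : C, Finite (X ⟶ Y)

/-- Finitary: `Hom`-finite, and every set `Ext¹(a, b)` is finite. -/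
structure Finitary : Prop where
  homFinite : E.HomFinite
  finite_ext : ∀ a b : IsoClass C, (E.ext a b).Finite

/-- Profinitary: `Hom`-finite, and every Grothendieck class is finite. -/
structure Profinitary : Prop where
  homFinite : E.HomFinite
  finite_isoGrade : ∀ γ : E.GrothendieckMonoid, (E.isoGrade γ).Finite

/-- Cofinitary: `Hom`-finite, and every class is an extension in finitely many ways. -/
structure Cofinitary : Prop where
  homFinite : E.HomFinite
  finite_coext : ∀ x : IsoClass C, {p : IsoClass C × IsoClass C | x ∈ E.ext p.1 p.2}.Finite

theorem Profinitary.finitary {E : ExactStructure C} (hE : E.Profinitary) : E.Finitary :=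
  ⟨hE.homFinite, fun a b => (hE.finite_isoGrade (E.grade (a + b))).subset
    fun _ hx => E.grade_of_mem_ext hx⟩

end Extensions

section HallNumbers

variable (E : ExactStructure C)

/-- The set `𝓔(A, B)_X` of all short exact sequences `B ↣ X ↠ A`. -/
def Sequences (A B X : C) : Type v :=
  {p : (B ⟶ X) × (X ⟶ A) // ∃ w : p.1 ≫ p.2 = 0, E.Exact (ShortComplex.mk p.1 p.2 w)}

/-- `Aut A × Aut B` acts on `𝓔(A, B)_X` by `(ψ, φ) • (f, g) = (f ∘ φ⁻¹, ψ ∘ g)`. -/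
instance Sequences.instMulAction (A B X : C) : MulAction (Aut A × Aut B) (E.Sequences A B X) where
  smul σ p := ⟨(σ.2.inv ≫ p.1.1, p.1.2 ≫ σ.1.hom), by
    obtain ⟨⟨f, g⟩, w, h⟩ := p
    dsimp only at w h ⊢
    refine ⟨by simp [reassoc_of% w], E.of_iso ?_ h⟩
    exact ShortComplex.isoMk σ.2 (Iso.refl _) σ.1
      ((Iso.hom_inv_id_assoc σ.2 f).trans (Category.comp_id f).symm) (Category.id_comp _)⟩
  one_smul p := by
    refine Subtype.ext (Prod.ext ?_ ?_)
    · exact Category.id_comp p.1.1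
    · exact Category.comp_id p.1.2
  mul_smul σ τ p := by
    refine Subtype.ext (Prod.ext ?_ ?_)
    · exact Category.assoc σ.2.inv τ.2.inv p.1.1
    · exact (Category.assoc p.1.2 τ.1.hom σ.1.hom).symm

/-- The Hall number `F_{AB}^X`: the number of `Aut A × Aut B`-orbits in `𝓔(A, B)_X`. -/
noncomputable def hallNumber (A B X : C) : ℕ :=
  Nat.card (MulAction.orbitRel.Quotient (Aut A × Aut B) (E.Sequences A B X))

/-- The action is free, so `F_{AB}^X = #𝓔(A, B)_X / #(Aut A × Aut B)`. -/
theorem hallNumber_mul_card (A B X : C) :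
    E.hallNumber A B X * Nat.card (Aut A × Aut B) = Nat.card (E.Sequences A B X) := by
  have hfree : ∀ p : E.Sequences A B X, MulAction.stabilizer (Aut A × Aut B) p = ⊥ := by
    intro p
    obtain ⟨w, h⟩ := p.2
    obtain ⟨hk⟩ := E.isKernel h
    obtain ⟨hc⟩ := E.isCokernel h
    have hf : Mono p.1.1 := mono_of_isLimit_fork hk
    have hg : Epi p.1.2 := epi_of_isColimit_cofork hc
    refine (Subgroup.eq_bot_iff_forall _).2 ?_
    rintro ⟨ψ, φ⟩ hσ
    have hs : ((ψ, φ) : Aut A × Aut B) • p = p := MulAction.mem_stabilizer_iff.1 hσ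
    have hσ' := congrArg Subtype.val hs
    have h1 : φ.inv ≫ p.1.1 = p.1.1 := congrArg Prod.fst hσ'
    have h2 : p.1.2 ≫ ψ.hom = p.1.2 := congrArg Prod.snd hσ'
    have h3 : φ.inv = 𝟙 B := by rw [← cancel_mono p.1.1, h1, Category.id_comp]
    have h4 : ψ.hom = 𝟙 A := by rw [← cancel_epi p.1.2, h2, Category.comp_id]
    exact Prod.ext (Iso.ext h4) (Iso.ext ((Iso.inv_eq_inv φ (Iso.refl B)).1 h3))
  rw [hallNumber, ← Nat.card_prod]
  exact (Nat.card_congr (MulAction.selfEquivOrbitsQuotientProd hfree)).symm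

/-- Transport of short exact sequences along isomorphisms of the three objects. -/
def transport {A A' B B' X X' : C} (eA : A ≅ A') (eB : B ≅ B') (eX : X ≅ X') :
    E.Sequences A B X ≃ E.Sequences A' B' X' where
  toFun p := ⟨(eB.inv ≫ p.1.1 ≫ eX.hom, eX.inv ≫ p.1.2 ≫ eA.hom), by
    obtain ⟨⟨f, g⟩, w, h⟩ := p
    dsimp only at w h ⊢
    exact ⟨by simp [reassoc_of% w],
      E.of_iso (ShortComplex.isoMk eB eX eA (by simp) (by simp)) h⟩⟩
  invFun p := ⟨(eB.hom ≫ p.1.1 ≫ eX.inv, eX.hom ≫ p.1.2 ≫ eA.inv), by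
    obtain ⟨⟨f, g⟩, w, h⟩ := p
    dsimp only at w h ⊢
    exact ⟨by simp [reassoc_of% w],
      E.of_iso (ShortComplex.isoMk eB.symm eX.symm eA.symm (by simp) (by simp)) h⟩⟩
  left_inv p := Subtype.ext (by simp)
  right_inv p := Subtype.ext (by simp)

/-- Isomorphic objects have the same Hall numbers. -/
theorem hallNumber_congr {A A' B B' X X' : C} (eA : A ≅ A') (eB : B ≅ B') (eX : X ≅ X') :
    E.hallNumber A B X = E.hallNumber A' B' X' := by
  refine Nat.card_congr (Quotient.congr (transport E eA eB eX) fun p q => ?_)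
  change p ∈ MulAction.orbit _ q ↔ transport E eA eB eX p ∈ MulAction.orbit _ _
  constructor
  · rintro ⟨⟨ψ, φ⟩, rfl⟩
    refine ⟨(eA.symm ≪≫ ψ ≪≫ eA, eB.symm ≪≫ φ ≪≫ eB), Subtype.ext (Prod.ext ?_ ?_)⟩
    · change ((eB.inv ≫ φ.inv) ≫ eB.hom) ≫ eB.inv ≫ q.1.1 ≫ eX.hom =
        eB.inv ≫ (φ.inv ≫ q.1.1) ≫ eX.hom
      simp
    · change (eX.inv ≫ q.1.2 ≫ eA.hom) ≫ eA.inv ≫ ψ.hom ≫ eA.hom =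
        eX.inv ≫ (q.1.2 ≫ ψ.hom) ≫ eA.hom
      simp
  · rintro ⟨⟨ψ, φ⟩, h⟩
    have h' := congrArg Subtype.val h
    have h1 : φ.inv ≫ eB.inv ≫ q.1.1 ≫ eX.hom = eB.inv ≫ p.1.1 ≫ eX.hom :=
      congrArg Prod.fst h'
    have h2 : (eX.inv ≫ q.1.2 ≫ eA.hom) ≫ ψ.hom = eX.inv ≫ p.1.2 ≫ eA.hom :=
      congrArg Prod.snd h'
    refine ⟨(eA ≪≫ ψ ≪≫ eA.symm, eB ≪≫ φ ≪≫ eB.symm), Subtype.ext (Prod.ext ?_ ?_)⟩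
    · change ((eB.hom ≫ φ.inv) ≫ eB.inv) ≫ q.1.1 = p.1.1
      rw [← cancel_mono eX.hom, ← cancel_epi eB.inv, ← h1]
      simp
    · change q.1.2 ≫ eA.hom ≫ ψ.hom ≫ eA.inv = p.1.2
      rw [← cancel_mono eA.hom, ← cancel_epi eX.inv, Category.assoc, ← h2]
      simp

/-- The Hall number `F_{ab}^x` of isomorphism classes. -/
noncomputable def hallCoeff (a b x : IsoClass C) : ℚ := E.hallNumber a.rep b.rep x.rep

theorem hallCoeff_mk (A B X : C) :
    E.hallCoeff (IsoClass.mk A) (IsoClass.mk B) (IsoClass.mk X) = E.hallNumber A B X := by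
  obtain ⟨eA⟩ := IsoClass.mk_eq_iff.1 (IsoClass.mk_rep (IsoClass.mk A))
  obtain ⟨eB⟩ := IsoClass.mk_eq_iff.1 (IsoClass.mk_rep (IsoClass.mk B))
  obtain ⟨eX⟩ := IsoClass.mk_eq_iff.1 (IsoClass.mk_rep (IsoClass.mk X))
  exact congrArg Nat.cast (E.hallNumber_congr eA eB eX)

/-- The coefficient `F_{ab}^x` vanishes outside of `Ext¹(a, b)`. -/
theorem hallCoeff_eq_zero {a b x : IsoClass C} (h : x ∉ E.ext a b) : E.hallCoeff a b x = 0 := by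
  have hempty : IsEmpty (E.Sequences a.rep b.rep x.rep) :=
    ⟨fun ⟨_, _, hp⟩ => h ⟨_, hp, b.mk_rep, x.mk_rep, a.mk_rep⟩⟩
  have hq : IsEmpty (MulAction.orbitRel.Quotient (Aut a.rep × Aut b.rep)
      (E.Sequences a.rep b.rep x.rep)) := ⟨fun q => Quotient.inductionOn q hempty.false⟩
  simp [hallCoeff, hallNumber]

/-- The dual Hall number `F^{ab}_x = #(Aut a × Aut b) / #(Aut x) * F_{ba}^x`. -/
noncomputable def dualHall (a b x : IsoClass C) : ℚ :=
  Nat.card (Aut a.rep × Aut b.rep) / Nat.card (Aut x.rep) * E.hallCoeff b a x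

end HallNumbers

end ExactStructure

/-- The rational vector space `H` with basis the isomorphism classes of objects. -/
abbrev Hall (C : Type u) [Category.{v} C] : Type u := IsoClass C →₀ ℚ

/-- The basis vector `[X]`. -/
noncomputable abbrev basisVec {C : Type u} [Category.{v} C] (x : IsoClass C) : Hall C :=
  Finsupp.single x 1

namespace ExactStructure

variable {C : Type u} [Category.{v} C] [Preadditive C] [HasZeroObject C] [HasBinaryBiproducts C]

section Operations

variable {E : ExactStructure C}

/-- The Hall product `[A] · [B] = ∑ F_{AB}^X [X]`. The sum is over `Ext¹([A], [B])`, which is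
finite and outside of which `F_{AB}^X` vanishes. -/
noncomputable def Finitary.mul (hE : E.Finitary) : Hall C →ₗ[ℚ] Hall C →ₗ[ℚ] Hall C :=
  Finsupp.linearCombination ℚ fun a => Finsupp.linearCombination ℚ fun b =>
    ∑ x ∈ (hE.finite_ext a b).toFinset, E.hallCoeff a b x • basisVec x

/-- The coproduct `Δ[X] = ∑ F^{AB}_X [A] ⊗ [B]`. The sum is over the pairs with
`[X] ∈ Ext¹([B], [A])`, which are finitely many and outside of which `F^{AB}_X` vanishes. -/
noncomputable def Cofinitary.comul (hE : E.Cofinitary) : Hall C →ₗ[ℚ] Hall C ⊗[ℚ] Hall C :=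
  Finsupp.linearCombination ℚ fun x =>
    ∑ p ∈ (hE.finite_coext x).toFinset,
      E.dualHall p.2 p.1 x • (basisVec p.2 ⊗ₜ[ℚ] basisVec p.1)

/-- The space of primitive elements: `Δ c = c ⊗ 1 + 1 ⊗ c` with `1 = [0]`. -/
noncomputable def Cofinitary.prim (hE : E.Cofinitary) : Submodule ℚ (Hall C) where
  carrier := {c | hE.comul c = c ⊗ₜ[ℚ] basisVec 0 + basisVec 0 ⊗ₜ[ℚ] c}
  zero_mem' := by simp
  add_mem' {c d} hc hd := by
    simp only [Set.mem_ofPred_eq] at hc hd ⊢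
    rw [map_add, hc, hd, TensorProduct.add_tmul, TensorProduct.tmul_add]
    abel
  smul_mem' r c hc := by
    simp only [Set.mem_ofPred_eq] at hc ⊢
    rw [map_smul, hc, smul_add, TensorProduct.smul_tmul', TensorProduct.tmul_smul]

end Operations

/-- The counit `ε [X] = δ_{[0], [X]}`. -/
noncomputable def counit (C : Type u) [Category.{v} C] [Preadditive C] [HasZeroObject C]
    [HasBinaryBiproducts C] : Hall C →ₗ[ℚ] ℚ :=
  Finsupp.lapply 0

/-- `P = ker ε · ker ε`: the span of all products of two elements of `ker ε`. -/
noncomputable def Finitary.decomposables {E : ExactStructure C} (hE : E.Finitary) :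
    Submodule ℚ (Hall C) :=
  Submodule.map₂ hE.mul (LinearMap.ker (counit C)) (LinearMap.ker (counit C))

section Grading

variable (E : ExactStructure C)

/-- The homogeneous component `H_γ`, spanned by `Iso C_γ`. -/
noncomputable def component (γ : E.GrothendieckMonoid) : Submodule ℚ (Hall C) :=
  Submodule.span ℚ (basisVec '' E.isoGrade γ)

/-- The set `Ind C_γ` of isomorphism classes of indecomposable objects of class `γ`. -/
def indGrade (γ : E.GrothendieckMonoid) : Set (IsoClass C) :=
  {x | x ∈ E.isoGrade γ ∧ ∃ X : C, IsoClass.mk X = x ∧ Indecomposable X}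

/-- `ℚ Ind C_γ` -/
noncomputable def indSpan (γ : E.GrothendieckMonoid) : Submodule ℚ (Hall C) :=
  Submodule.span ℚ (basisVec '' E.indGrade γ)

/-- The component `Prim(H)_γ = Prim(H) ∩ H_γ`. -/
noncomputable def primGrade (hc : E.Cofinitary) (γ : E.GrothendieckMonoid) :
    Submodule ℚ (Hall C) :=
  hc.prim ⊓ E.component γ

/-- The component `P_γ = P ∩ H_γ`. -/
noncomputable def decomposablesGrade (hf : E.Finitary) (γ : E.GrothendieckMonoid) :
    Submodule ℚ (Hall C) :=
  hf.decomposables ⊓ E.component γ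

/-- The multiplicity `m_γ = #Ind C_γ - dim Prim(H)_γ`. -/
noncomputable def multiplicity (hc : E.Cofinitary) (γ : E.GrothendieckMonoid) : ℤ :=
  (E.indGrade γ).ncard - Module.finrank ℚ (E.primGrade hc γ)

end Grading

end ExactStructure

end HallAlgebra

open HallAlgebra

namespace HallAlgebra

/-! Two facts about a nonzero degree `γ` give the formula by linear algebra in the
finite-dimensional space `H_γ`.

First, `Prim_γ` is the orthogonal complement of `P_γ` for the form with `⟨[X], [Y]⟩ = δ / #Aut X`.
The factor `#(Aut A × Aut B) / #Aut C` in the coproduct makes it adjoint to the opposite product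
(`comul_apply`), so being primitive means being orthogonal to all products of two nonzero classes
(`mem_prim_iff_greenForm`). The form is nondegenerate on `H_γ`, hence `dim Prim_γ + dim P_γ = dim
H_γ` (`finrank_primGrade_add`).

Second, `P_γ + ℚ Ind_γ = H_γ` (`decomposablesGrade_sup_indSpan`). If `X ≅ A ⊕ B` with `A`, `B`
nonzero, then `[A]·[B]` is a nonzero multiple of `[X]` plus terms `[Y]` with `Y` the middle of a
non-split extension. Such a `Y` has strictly fewer endomorphisms than `X` (`Exact.card_end_lt`), so
induction on `#End X` applies.

The dimension formula for a sum and an intersection then yields `dim (P_γ ∩ ℚ Ind_γ) = #Ind_γ - dim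
Prim_γ`. Neither associativity of the product nor compatibility of product and coproduct is needed.
-/

theorem IsoClass.isZero_rep_zero {C : Type u} [Category.{v} C] [HasZeroObject C] :
    IsZero (IsoClass.rep (0 : IsoClass C)) := by
  obtain ⟨e⟩ := IsoClass.mk_eq_iff.1 (IsoClass.mk_rep (0 : IsoClass C))
  exact (isZero_zero C).of_iso e

theorem IsoClass.mk_eq_zero_iff {C : Type u} [Category.{v} C] [HasZeroObject C] {X : C} :
    IsoClass.mk X = 0 ↔ IsZero X :=
  IsoClass.mk_eq_iff.trans
    ⟨fun ⟨e⟩ => (isZero_zero C).of_iso e, fun h => ⟨h.iso (isZero_zero C)⟩⟩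

theorem card_biprod_hom {C : Type u} [Category.{v} C] [Preadditive C] [HasBinaryBiproducts C]
    (A B M : C) :
    Nat.card (A ⊞ B ⟶ M) = Nat.card (A ⟶ M) * Nat.card (B ⟶ M) := by
  rw [← Nat.card_prod]
  exact Nat.card_congr
    { toFun f := (biprod.inl ≫ f, biprod.inr ≫ f)
      invFun p := biprod.desc p.1 p.2
      left_inv f := by ext <;> simp
      right_inv p := by simp }

theorem card_hom_biprod {C : Type u} [Category.{v} C] [Preadditive C] [HasBinaryBiproducts C]
    (A B M : C) :
    Nat.card (M ⟶ A ⊞ B) = Nat.card (M ⟶ A) * Nat.card (M ⟶ B) := by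
  rw [← Nat.card_prod]
  exact Nat.card_congr
    { toFun f := (f ≫ biprod.fst, f ≫ biprod.snd)
      invFun p := biprod.lift p.1 p.2
      left_inv f := by ext <;> simp
      right_inv p := by simp }

/-! ### Green's form. -/

section Form

variable {C : Type u} [Category.{v} C]

theorem finrank_span_basisVec (s : Set (IsoClass C)) :
    Module.finrank ℚ (Submodule.span ℚ (basisVec '' s)) = s.ncard := by
  have h : LinearIndependent ℚ (fun x : s => basisVec x.1) :=
    (Finsupp.linearIndependent_single_one ℚ (IsoClass C)).comp _ Subtype.val_injective
  -- The comparison is made between cardinals, so no finiteness of `s` is needed: both sides are `0`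
  -- when `s` is infinite.
  rw [Set.image_eq_range, Module.finrank, rank_span h, ← Set.image_eq_range,
    Cardinal.mk_image_eq (Finsupp.single_left_injective one_ne_zero)]
  rfl

/-- Green's form on the Hall algebra, `⟨[X], [Y]⟩ = δ / #Aut X`. -/
noncomputable def greenForm (C : Type u) [Category.{v} C] : LinearMap.BilinForm ℚ (Hall C) :=
  Finsupp.linearCombination ℚ fun x => (Nat.card (Aut x.rep) : ℚ)⁻¹ • Finsupp.lapply x

theorem greenForm_basisVec_left (x : IsoClass C) (d : Hall C) :
    greenForm C (basisVec x) d = (Nat.card (Aut x.rep) : ℚ)⁻¹ * d x := by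
  simp [greenForm]

theorem greenForm_basisVec_right (c : Hall C) (x : IsoClass C) :
    greenForm C c (basisVec x) = (Nat.card (Aut x.rep) : ℚ)⁻¹ * c x := by
  classical
  induction c using Finsupp.induction_linear with
  | zero => simp
  | add c d hc hd => simp [hc, hd, mul_add]
  | single y r =>
    rw [← mul_one r, ← smul_eq_mul, ← Finsupp.smul_single, map_smul, LinearMap.smul_apply,
      greenForm_basisVec_left, Finsupp.smul_apply]
    by_cases h : x = y
    · subst h; simp; ring
    · simp [h, Ne.symm h]

theorem greenForm_isSymm : (greenForm C).IsSymm := by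
  refine ⟨fun c d => ?_⟩
  induction d using Finsupp.induction_linear with
  | zero => simp
  | add d d' hd hd' => simp_all
  | single y r =>
    rw [← mul_one r, ← smul_eq_mul, ← Finsupp.smul_single]
    simp only [map_smul, LinearMap.smul_apply, greenForm_basisVec_left,
      greenForm_basisVec_right]

/-- Distinct basis vectors are orthogonal. Applied to two different degrees, this makes the
homogeneous components pairwise orthogonal. -/
theorem greenForm_eq_zero_of_disjoint {c d : Hall C} {s t : Set (IsoClass C)} (hst : Disjoint s t)
    (hc : c ∈ Finsupp.supported ℚ ℚ s) (hd : d ∈ Finsupp.supported ℚ ℚ t) :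
    greenForm C c d = 0 := by
  rw [greenForm, Finsupp.linearCombination_apply, Finsupp.sum, LinearMap.sum_apply]
  refine Finset.sum_eq_zero fun x hx => ?_
  have : d x = 0 := (Finsupp.mem_supported' ℚ d).1 hd x
    (Set.disjoint_left.1 hst ((Finsupp.mem_supported ℚ c).1 hc hx))
  simp [this]

end Form

namespace ExactStructure

variable {C : Type u} [Category.{v} C] [Preadditive C] [HasZeroObject C] [HasBinaryBiproducts C]
  {E : ExactStructure C}

/-! ### Counting morphisms along short exact sequences. -/

theorem Exact.epi {S : ShortComplex C} (h : E.Exact S) : Epi S.g :=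
  let ⟨hc⟩ := E.isCokernel h
  epi_of_isColimit_cofork hc

/-- A short exact sequence whose first map has a retraction splits. -/
theorem Exact.nonempty_iso_of_retraction {S : ShortComplex C} (h : E.Exact S) (r : S.X₂ ⟶ S.X₁)
    (hr : S.f ≫ r = 𝟙 _) : Nonempty (S.X₂ ≅ S.X₃ ⊞ S.X₁) := by
  obtain ⟨hc⟩ := E.isCokernel h
  have := h.epi
  -- The idempotent complementary to `r ≫ S.f` vanishes on `S.f`, so it factors through the
  -- cokernel; the factor is a section of `S.g`.
  obtain ⟨s, hs⟩ := CokernelCofork.IsColimit.desc' hc (𝟙 _ - r ≫ S.f)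
    (by rw [Preadditive.comp_sub, reassoc_of% hr]; simp)
  replace hs : S.g ≫ s = 𝟙 _ - r ≫ S.f := hs
  have hsg : s ≫ S.g = 𝟙 _ := by
    rw [← cancel_epi S.g, ← Category.assoc, hs, Preadditive.sub_comp]
    simp
  exact ⟨(ShortComplex.Splitting.mk r s hr hsg (by rw [hs]; abel)).isoBinaryBiproduct ≪≫
    biprod.braiding _ _⟩

/-- `Hom(-, M)` is left exact, so `#Hom(X, M) ≤ #Hom(A, M) * #Hom(B, M)`. -/
theorem Exact.card_hom_le_mul_range {S : ShortComplex C} (h : E.Exact S) (hE : E.HomFinite)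
    (M : C) : Nat.card (S.X₂ ⟶ M) ≤
      Nat.card (S.X₃ ⟶ M) * Nat.card (Preadditive.leftComp M S.f).range := by
  have := hE S.X₃ M
  obtain ⟨hc⟩ := E.isCokernel h
  set φ := Preadditive.leftComp M S.f
  rw [← AddSubgroup.card_mul_index φ.ker, AddSubgroup.index_ker]
  refine Nat.mul_le_mul_right _ ?_
  have hd (k : φ.ker) : ∃ d : S.X₃ ⟶ M, S.g ≫ d = k.1 :=
    let ⟨d, hd⟩ := CokernelCofork.IsColimit.desc' hc k.1 k.2
    ⟨d, hd⟩
  choose d hd using hd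
  exact Nat.card_le_card_of_injective d fun k k' hk => Subtype.ext (by rw [← hd, ← hd, hk])

theorem Exact.card_hom_le {S : ShortComplex C} (h : E.Exact S) (hE : E.HomFinite) (M : C) :
    Nat.card (S.X₂ ⟶ M) ≤ Nat.card (S.X₃ ⟶ M) * Nat.card (S.X₁ ⟶ M) := by
  have := hE S.X₁ M
  exact (h.card_hom_le_mul_range hE M).trans
    (Nat.mul_le_mul_left _ (Nat.card_le_card_of_injective _ Subtype.val_injective))

/-- `Hom(M, -)` is left exact, so `#Hom(M, X) ≤ #Hom(M, B) * #Hom(M, A)`. -/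
theorem Exact.card_hom_le' {S : ShortComplex C} (h : E.Exact S) (hE : E.HomFinite) (M : C) :
    Nat.card (M ⟶ S.X₂) ≤ Nat.card (M ⟶ S.X₁) * Nat.card (M ⟶ S.X₃) := by
  have := hE M S.X₁
  have := hE M S.X₃
  obtain ⟨hk⟩ := E.isKernel h
  set φ := Preadditive.rightComp M S.g
  rw [← AddSubgroup.card_mul_index φ.ker, AddSubgroup.index_ker]
  refine Nat.mul_le_mul ?_ (Nat.card_le_card_of_injective _ Subtype.val_injective)
  have hd (k : φ.ker) : ∃ d : M ⟶ S.X₁, d ≫ S.f = k.1 :=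
    let ⟨d, hd⟩ := KernelFork.IsLimit.lift' hk k.1 k.2
    ⟨d, hd⟩
  choose d hd using hd
  exact Nat.card_le_card_of_injective d fun k k' hk => Subtype.ext (by rw [← hd, ← hd, hk])

/-- Strictness comes from the range of restriction along `S.f`. Were it all of `End S.X₁`, the
identity would extend to `S.X₂`, giving a retraction and hence a splitting. -/
theorem Exact.card_hom_lt {S : ShortComplex C} (h : E.Exact S) (hE : E.HomFinite)
    (hs : IsEmpty (S.X₂ ≅ S.X₃ ⊞ S.X₁)) :
    Nat.card (S.X₂ ⟶ S.X₁) < Nat.card (S.X₃ ⟶ S.X₁) * Nat.card (S.X₁ ⟶ S.X₁) := by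
  have := hE S.X₁ S.X₁
  have := hE S.X₃ S.X₁
  refine (h.card_hom_le_mul_range hE S.X₁).trans_lt
    (Nat.mul_lt_mul_of_pos_left (lt_of_not_ge fun hle => ?_) Nat.card_pos)
  have htop := AddSubgroup.eq_top_of_le_card _ hle
  obtain ⟨r, hr⟩ : 𝟙 S.X₁ ∈ (Preadditive.leftComp S.X₁ S.f).range := htop ▸ AddSubgroup.mem_top _
  exact hs.elim (h.nonempty_iso_of_retraction r hr).some

/-- The middle term of a non-split short exact sequence has fewer endomorphisms than the sum of
the outer terms. -/
theorem Exact.card_end_lt {S : ShortComplex C} (h : E.Exact S) (hE : E.HomFinite)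
    (hs : IsEmpty (S.X₂ ≅ S.X₃ ⊞ S.X₁)) :
    Nat.card (S.X₂ ⟶ S.X₂) < Nat.card (S.X₃ ⊞ S.X₁ ⟶ S.X₃ ⊞ S.X₁) := by
  have hpos : 0 < Nat.card (S.X₃ ⟶ S.X₃) * Nat.card (S.X₁ ⟶ S.X₃) :=
    have := hE S.X₃ S.X₃
    have := hE S.X₁ S.X₃
    Nat.mul_pos Nat.card_pos Nat.card_pos
  -- Hom-counts are multiplicative on biproducts, so left exactness in each variable gives the weak
  -- inequality. Only the factor `Hom(S.X₂, S.X₁)` is strictly smaller; the remaining factor must be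
  -- positive for strictness to survive.
  rw [card_hom_biprod, card_biprod_hom, card_biprod_hom, mul_comm]
  calc _ ≤ Nat.card (S.X₂ ⟶ S.X₁) * Nat.card (S.X₂ ⟶ S.X₃) := h.card_hom_le' hE _
    _ ≤ Nat.card (S.X₂ ⟶ S.X₁) * (Nat.card (S.X₃ ⟶ S.X₃) * Nat.card (S.X₁ ⟶ S.X₃)) :=
      Nat.mul_le_mul_left _ (h.card_hom_le hE _)
    _ < _ := Nat.mul_lt_mul_of_pos_right (h.card_hom_lt hE hs) hpos

/-! ### Nonvanishing of Hall numbers, and Hall numbers with a zero outer term. -/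

theorem nonempty_sequences_iff {a b x : IsoClass C} :
    Nonempty (E.Sequences a.rep b.rep x.rep) ↔ x ∈ E.ext a b := by
  refine ⟨fun ⟨⟨_, _, hp⟩⟩ => ⟨_, hp, b.mk_rep, x.mk_rep, a.mk_rep⟩, ?_⟩
  rintro ⟨S, hS, rfl, rfl, rfl⟩
  obtain ⟨e₁⟩ := IsoClass.mk_eq_iff.1 (IsoClass.mk_rep (IsoClass.mk S.X₁))
  obtain ⟨e₂⟩ := IsoClass.mk_eq_iff.1 (IsoClass.mk_rep (IsoClass.mk S.X₂))
  obtain ⟨e₃⟩ := IsoClass.mk_eq_iff.1 (IsoClass.mk_rep (IsoClass.mk S.X₃))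
  exact ⟨transport E e₃.symm e₁.symm e₂.symm ⟨(S.f, S.g), S.zero, hS⟩⟩

/-- The free action gives `F · #(Aut A × Aut B) = #𝓔(A, B)_X`, and the right side is positive
because the set of sequences is nonempty and, by Hom-finiteness, finite. -/
theorem hallCoeff_ne_zero (hE : E.HomFinite) {a b x : IsoClass C} (h : x ∈ E.ext a b) :
    E.hallCoeff a b x ≠ 0 := by
  have := nonempty_sequences_iff.2 h
  have := hE b.rep x.rep
  have := hE x.rep a.rep
  have : Finite (E.Sequences a.rep b.rep x.rep) := Subtype.finite
  intro h0
  have := E.hallNumber_mul_card a.rep b.rep x.rep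
  rw [Nat.cast_eq_zero.1 h0, zero_mul] at this
  exact Nat.card_pos.ne this

theorem card_aut_pos (hE : E.HomFinite) (X : C) : 0 < Nat.card (Aut X) := by
  have := hE X X
  have : Finite (Aut X) := Finite.of_injective (fun f : Aut X => (f.hom : X ⟶ X))
    fun _ _ h => Iso.ext h
  exact Nat.card_pos

theorem isIso_g_of_isZero {A B X : C} (hB : IsZero B) (p : E.Sequences A B X) : IsIso p.1.2 := by
  obtain ⟨⟨f, g⟩, w, h⟩ := p
  obtain ⟨hc⟩ := E.isCokernel h
  exact CokernelCofork.IsColimit.isIso_π _ hc (hB.eq_of_src _ _)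

theorem isIso_f_of_isZero {A B X : C} (hA : IsZero A) (p : E.Sequences A B X) : IsIso p.1.1 := by
  obtain ⟨⟨f, g⟩, w, h⟩ := p
  obtain ⟨hk⟩ := E.isKernel h
  exact KernelFork.IsLimit.isIso_ι _ hk (hA.eq_of_tgt _ _)

open Classical in
-- When the subobject is zero, the second map is an isomorphism, and any two isomorphisms differ by
-- an automorphism of the target: there is a single orbit.
theorem hallCoeff_zero_right (a x : IsoClass C) :
    E.hallCoeff a 0 x = if x = a then 1 else 0 := by
  split_ifs with hx
  · subst hx
    have hx := E.add_mem_ext x 0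
    rw [add_zero] at hx
    obtain ⟨p₀⟩ := nonempty_sequences_iff.2 hx
    rw [hallCoeff, hallNumber, Nat.cast_eq_one, Nat.card_eq_one_iff_unique]
    refine ⟨⟨fun p q => Quotient.inductionOn₂ p q fun p q => Quotient.sound ?_⟩,
      ⟨Quotient.mk _ p₀⟩⟩
    have := isIso_g_of_isZero IsoClass.isZero_rep_zero p
    have := isIso_g_of_isZero IsoClass.isZero_rep_zero q
    refine ⟨((asIso q.1.2).symm ≪≫ asIso p.1.2, Iso.refl _), Subtype.ext (Prod.ext ?_ ?_)⟩
    · exact IsoClass.isZero_rep_zero.eq_of_src _ _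
    · exact IsIso.hom_inv_id_assoc q.1.2 p.1.2
  · refine E.hallCoeff_eq_zero fun h => hx ?_
    obtain ⟨p⟩ := nonempty_sequences_iff.2 h
    have := isIso_g_of_isZero IsoClass.isZero_rep_zero p
    rw [← x.mk_rep, ← a.mk_rep]
    exact IsoClass.mk_eq_iff.2 ⟨asIso p.1.2⟩

open Classical in
theorem hallCoeff_zero_left (b x : IsoClass C) :
    E.hallCoeff 0 b x = if x = b then 1 else 0 := by
  split_ifs with hx
  · subst hx
    have hx := E.add_mem_ext 0 x
    rw [zero_add] at hx
    obtain ⟨p₀⟩ := nonempty_sequences_iff.2 hx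
    rw [hallCoeff, hallNumber, Nat.cast_eq_one, Nat.card_eq_one_iff_unique]
    refine ⟨⟨fun p q => Quotient.inductionOn₂ p q fun p q => Quotient.sound ?_⟩,
      ⟨Quotient.mk _ p₀⟩⟩
    have := isIso_f_of_isZero IsoClass.isZero_rep_zero p
    have := isIso_f_of_isZero IsoClass.isZero_rep_zero q
    refine ⟨(Iso.refl _, asIso q.1.1 ≪≫ (asIso p.1.1).symm), Subtype.ext (Prod.ext ?_ ?_)⟩
    · change (p.1.1 ≫ inv q.1.1) ≫ q.1.1 = p.1.1
      simp
    · exact IsoClass.isZero_rep_zero.eq_of_tgt _ _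
  · refine E.hallCoeff_eq_zero fun h => hx ?_
    obtain ⟨p⟩ := nonempty_sequences_iff.2 h
    have := isIso_f_of_isZero IsoClass.isZero_rep_zero p
    rw [← x.mk_rep, ← b.mk_rep]
    exact IsoClass.mk_eq_iff.2 ⟨(asIso p.1.1).symm⟩

open Classical in
-- Since `#Aut 0 = 1`, the automorphism factors cancel when `x = b`. This and its mirror image
-- amount to the counit laws.
theorem dualHall_zero_left (hE : E.HomFinite) (b x : IsoClass C) :
    E.dualHall 0 b x = if x = b then 1 else 0 := by
  have : Nat.card (Aut (IsoClass.rep (0 : IsoClass C))) = 1 :=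
    Nat.card_eq_one_iff_unique.2
      ⟨⟨fun f g => Iso.ext (IsoClass.isZero_rep_zero.eq_of_src _ _)⟩, ⟨Iso.refl _⟩⟩
  rw [dualHall, hallCoeff_zero_right, Nat.card_prod, this]
  split_ifs with h
  · subst h
    have := (card_aut_pos hE x.rep).ne'
    field_simp
    simp
  · simp

open Classical in
theorem dualHall_zero_right (hE : E.HomFinite) (a x : IsoClass C) :
    E.dualHall a 0 x = if x = a then 1 else 0 := by
  have : Nat.card (Aut (IsoClass.rep (0 : IsoClass C))) = 1 :=
    Nat.card_eq_one_iff_unique.2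
      ⟨⟨fun f g => Iso.ext (IsoClass.isZero_rep_zero.eq_of_src _ _)⟩, ⟨Iso.refl _⟩⟩
  rw [dualHall, hallCoeff_zero_left, Nat.card_prod, this]
  split_ifs with h
  · subst h
    have := (card_aut_pos hE x.rep).ne'
    field_simp
    simp
  · simp

/-! ### Homogeneous components and structure constants. -/

theorem component_eq_supported (γ : E.GrothendieckMonoid) :
    E.component γ = Finsupp.supported ℚ ℚ (E.isoGrade γ) :=
  (Finsupp.supported_eq_span_single ℚ (E.isoGrade γ)).symm

theorem indSpan_le_component (γ : E.GrothendieckMonoid) : E.indSpan γ ≤ E.component γ :=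
  Submodule.span_mono (Set.image_mono fun _ hx => hx.1)

theorem Finitary.mul_basisVec_apply (hf : E.Finitary) (a b x : IsoClass C) :
    hf.mul (basisVec a) (basisVec b) x = E.hallCoeff a b x := by
  classical
  rw [Finitary.mul, Finsupp.linearCombination_single, one_smul, Finsupp.linearCombination_single,
    one_smul, Finsupp.finsetSum_apply]
  by_cases hx : x ∈ E.ext a b
  · rw [Finset.sum_eq_single x (fun y _ hy => by simp [hy]) fun h => (h (by simpa using hx)).elim]
    simp
  · rw [E.hallCoeff_eq_zero hx]
    refine Finset.sum_eq_zero fun y hy => ?_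
    have : y ≠ x := fun h => hx (h ▸ by simpa using hy)
    simp [this]

/-- `finsuppTensorFinsupp'` identifies `H ⊗ H` with the finitely supported functions on pairs of
classes, so identities between tensors can be checked coefficient by coefficient. -/
theorem Cofinitary.comul_basisVec_apply (hc : E.Cofinitary) (a b x : IsoClass C) :
    finsuppTensorFinsupp' ℚ _ _ (hc.comul (basisVec x)) (a, b) = E.dualHall a b x := by
  classical
  rw [Cofinitary.comul, Finsupp.linearCombination_single, one_smul, map_sum,
    Finsupp.finsetSum_apply]
  simp only [map_smul, finsuppTensorFinsupp'_single_tmul_single, Finsupp.smul_apply, smul_eq_mul,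
    mul_one]
  by_cases hx : x ∈ E.ext b a
  · rw [Finset.sum_eq_single (b, a) (fun p _ hp => ?_) fun h => (h (by simpa using hx)).elim]
    · simp
    · rw [Finsupp.single_eq_of_ne, mul_zero]
      rintro h
      obtain ⟨rfl, rfl⟩ := Prod.mk.inj h
      exact hp rfl
  · rw [dualHall, E.hallCoeff_eq_zero hx, mul_zero]
    refine Finset.sum_eq_zero fun p hp => ?_
    rw [Finsupp.single_eq_of_ne, mul_zero]
    rintro h
    obtain ⟨rfl, rfl⟩ := Prod.mk.inj h
    exact hx (by simpa using hp)

/-- The classes of degree `γ` form an orthogonal basis, and `1 / #Aut X` is nonzero because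
automorphism groups are finite. -/
theorem greenForm_restrict_nondegenerate (hE : E.HomFinite) (γ : E.GrothendieckMonoid) :
    ((greenForm C).restrict (E.component γ)).Nondegenerate := by
  have key (c : E.component γ) (h : ∀ d : E.component γ, greenForm C c.1 d.1 = 0) : c = 0 := by
    refine Subtype.ext (Finsupp.ext fun x => ?_)
    by_cases hx : x ∈ E.isoGrade γ
    · have h := h ⟨basisVec x, Submodule.subset_span ⟨x, hx, rfl⟩⟩
      rw [greenForm_basisVec_right] at h
      exact (mul_eq_zero.1 h).resolve_left
        (inv_ne_zero (Nat.cast_ne_zero.2 (card_aut_pos hE x.rep).ne'))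
    · exact (Finsupp.mem_supported' ℚ c.1).1 (component_eq_supported γ ▸ c.2) x hx
  exact ⟨fun c h => key c h, fun c h => key c fun d => (greenForm_isSymm.eq _ _).symm.trans (h d)⟩

/-! ### Adjointness, and primitive elements as an orthogonal complement. -/

/-- The coproduct is adjoint to the opposite of the product. -/
theorem comul_apply (hf : E.Finitary) (hc : E.Cofinitary) (c : Hall C) (a b : IsoClass C) :
    finsuppTensorFinsupp' ℚ _ _ (hc.comul c) (a, b) =
      Nat.card (Aut a.rep × Aut b.rep) *
        greenForm C c (hf.mul (basisVec b) (basisVec a)) := by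
  induction c using Finsupp.induction_linear with
  | zero => simp
  | add c d hc hd => simp [hc, hd, mul_add]
  | single y r =>
    -- On a basis vector `[y]` both sides are `#(Aut a × Aut b) / #Aut y * F_{ba}^y`: the form
    -- supplies the denominator, and the swapped indices of the dual Hall number account for the
    -- opposite product.
    rw [← mul_one r, ← smul_eq_mul, ← Finsupp.smul_single, map_smul, map_smul, map_smul,
      LinearMap.smul_apply, Finsupp.smul_apply, hc.comul_basisVec_apply, greenForm_basisVec_left,
      hf.mul_basisVec_apply, dualHall, smul_eq_mul, smul_eq_mul]
    ring

theorem ker_counit :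
    LinearMap.ker (counit C) = Submodule.span ℚ (basisVec '' {(0 : IsoClass C)}ᶜ) := by
  rw [← Finsupp.supported_eq_span_single]
  ext c
  rw [Finsupp.mem_supported']
  simp [counit]

/-- These generators are homogeneous, which allows `P` to be studied one degree at a time. -/
theorem Finitary.decomposables_eq_span (hf : E.Finitary) :
    hf.decomposables = Submodule.span ℚ
      {c | ∃ a b : IsoClass C, a ≠ 0 ∧ b ≠ 0 ∧ hf.mul (basisVec a) (basisVec b) = c} := by
  rw [Finitary.decomposables, ker_counit, Submodule.map₂_span_span]
  congr 1
  ext c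
  constructor
  · rintro ⟨_, ⟨a, ha, rfl⟩, _, ⟨b, hb, rfl⟩, rfl⟩
    exact ⟨a, b, ha, hb, rfl⟩
  · rintro ⟨a, b, ha, hb, rfl⟩
    exact ⟨_, ⟨a, ha, rfl⟩, _, ⟨b, hb, rfl⟩, rfl⟩

theorem Finitary.mul_basisVec_mem_component (hf : E.Finitary) (a b : IsoClass C) :
    hf.mul (basisVec a) (basisVec b) ∈ E.component (E.grade (a + b)) := by
  rw [component_eq_supported, Finsupp.mem_supported']
  intro x hx
  rw [hf.mul_basisVec_apply]
  exact E.hallCoeff_eq_zero fun h => hx (E.grade_of_mem_ext h)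

theorem zero_notMem_isoGrade {γ : E.GrothendieckMonoid} (hγ : γ ≠ 0) :
    (0 : IsoClass C) ∉ E.isoGrade γ :=
  fun h => hγ (h.symm.trans (map_zero E.grothendieckCon.mk'))

/-- Compare coefficients at `(a, b)`. If `a` or `b` is `0`, the counit laws and `c 0 = 0` make the
equation automatic. Otherwise it says that the coefficient of `Δ c` vanishes, which by adjointness
is orthogonality to `[b]·[a]`. -/
theorem mem_prim_iff_greenForm (hf : E.Finitary) (hc : E.Cofinitary) {c : Hall C}
    (h0 : c 0 = 0) : c ∈ hc.prim ↔ ∀ d ∈ hf.decomposables, greenForm C c d = 0 := by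
  classical
  have hE := hf.homFinite
  have hleft (b : IsoClass C) :
      finsuppTensorFinsupp' ℚ _ _ (hc.comul c) (0, b) = c b := by
    -- The condition `c 0 = 0` is not inherited by summands of `c`, and the counit law holds without
    -- it.
    clear h0
    induction c using Finsupp.induction_linear with
    | zero => simp
    | add c d hc hd => simp [hc, hd]
    | single y r =>
      rw [← mul_one r, ← smul_eq_mul, ← Finsupp.smul_single, map_smul, map_smul,
        Finsupp.smul_apply, hc.comul_basisVec_apply, dualHall_zero_left hE, Finsupp.smul_apply,
        Finsupp.single_apply]
  have hright (a : IsoClass C) :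
      finsuppTensorFinsupp' ℚ _ _ (hc.comul c) (a, 0) = c a := by
    clear h0 hleft
    induction c using Finsupp.induction_linear with
    | zero => simp
    | add c d hc hd => simp [hc, hd]
    | single y r =>
      rw [← mul_one r, ← smul_eq_mul, ← Finsupp.smul_single, map_smul, map_smul,
        Finsupp.smul_apply, hc.comul_basisVec_apply, dualHall_zero_right hE, Finsupp.smul_apply,
        Finsupp.single_apply]
  have h1 : c ∈ hc.prim ↔ ∀ a b : IsoClass C,
      finsuppTensorFinsupp' ℚ _ _ (hc.comul c) (a, b) =
        c a * basisVec (0 : IsoClass C) b + basisVec (0 : IsoClass C) a * c b := by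
    change hc.comul c = _ ↔ _
    rw [← (finsuppTensorFinsupp' ℚ (IsoClass C) (IsoClass C)).injective.eq_iff, Finsupp.ext_iff,
      Prod.forall]
    simp only [map_add, Finsupp.add_apply, finsuppTensorFinsupp'_apply_apply]
  have h2 : (∀ d ∈ hf.decomposables, greenForm C c d = 0) ↔ ∀ a b : IsoClass C, a ≠ 0 → b ≠ 0 →
      greenForm C c (hf.mul (basisVec b) (basisVec a)) = 0 := by
    rw [hf.decomposables_eq_span]
    change Submodule.span ℚ _ ≤ LinearMap.ker (greenForm C c) ↔ _
    rw [Submodule.span_le]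
    constructor
    · exact fun h a b ha hb => h ⟨b, a, hb, ha, rfl⟩
    · rintro h _ ⟨a, b, ha, hb, rfl⟩
      exact h b a hb ha
  rw [h1, h2]
  refine forall₂_congr fun a b => ?_
  rcases eq_or_ne a 0 with rfl | ha
  · simp [hleft, h0]
  rcases eq_or_ne b 0 with rfl | hb
  · simp [hright, h0, ha]
  have hpos : (Nat.card (Aut a.rep × Aut b.rep) : ℚ) ≠ 0 := by
    rw [Nat.card_prod]
    exact Nat.cast_ne_zero.2 (Nat.mul_pos (card_aut_pos hE _) (card_aut_pos hE _)).ne'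
  simp [comul_apply hf, ha, hb, -Nat.card_prod, hpos]

/-- Within a nonzero degree the primitive elements are the orthogonal complement of the
decomposable ones. -/
theorem mem_primGrade_iff (hf : E.Finitary) (hc : E.Cofinitary) {γ : E.GrothendieckMonoid}
    (hγ : γ ≠ 0) {c : Hall C} (hcγ : c ∈ E.component γ) :
    c ∈ E.primGrade hc γ ↔ ∀ d ∈ E.decomposablesGrade hf γ, greenForm C c d = 0 := by
  have hcs := hcγ
  rw [component_eq_supported] at hcs
  have h0 : c 0 = 0 := (Finsupp.mem_supported' ℚ c).1 hcs 0 (zero_notMem_isoGrade hγ)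
  rw [primGrade, Submodule.mem_inf, and_iff_left hcγ, mem_prim_iff_greenForm hf hc h0]
  refine ⟨fun h d hd => h d hd.1, fun h d hd => ?_⟩
  rw [hf.decomposables_eq_span] at hd
  suffices hle : Submodule.span ℚ {c | ∃ a b : IsoClass C, a ≠ 0 ∧ b ≠ 0 ∧
      hf.mul (basisVec a) (basisVec b) = c} ≤ LinearMap.ker (greenForm C c) from hle hd
  rw [Submodule.span_le]
  rintro _ ⟨a, b, ha, hb, rfl⟩
  have hab := hf.mul_basisVec_mem_component a b
  -- A generator of `P` is homogeneous: either it lies in `P_γ`, or it has another degree and is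
  -- orthogonal to `c` in any case.
  by_cases hg : E.grade (a + b) = γ
  · refine h _ ⟨?_, hg ▸ hab⟩
    rw [hf.decomposables_eq_span]
    exact Submodule.subset_span ⟨a, b, ha, hb, rfl⟩
  · rw [component_eq_supported] at hab
    exact greenForm_eq_zero_of_disjoint
      (Set.disjoint_left.2 fun x hx hx' => hg (hx'.symm.trans hx)) hcs hab

theorem finrank_primGrade_add (hp : E.Profinitary) (hc : E.Cofinitary)
    {γ : E.GrothendieckMonoid} (hγ : γ ≠ 0) [Module.Finite ℚ (E.component γ)] :
    Module.finrank ℚ (E.primGrade hc γ) + Module.finrank ℚ (E.decomposablesGrade hp.finitary γ) =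
      Module.finrank ℚ (E.component γ) := by
  set V := E.component γ
  -- Nondegeneracy is available on `V`, so both spaces are regarded as subspaces of `V`; being
  -- contained in `V`, they keep their dimensions.
  set P : Submodule ℚ V := (E.decomposablesGrade hp.finitary γ).comap V.subtype
  have hP : Module.finrank ℚ P = Module.finrank ℚ (E.decomposablesGrade hp.finitary γ) :=
    (Submodule.comapSubtypeEquivOfLe inf_le_right).finrank_eq
  have hQ : ((greenForm C).restrict V).orthogonal P = (E.primGrade hc γ).comap V.subtype := by
    ext c
    rw [LinearMap.BilinForm.mem_orthogonal_iff, Submodule.mem_comap, V.subtype_apply,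
      mem_primGrade_iff hp.finitary hc hγ c.2]
    constructor
    · exact fun h d hd => (greenForm_isSymm.eq _ _).symm.trans (h ⟨d, hd.2⟩ hd)
    · exact fun h d hd => (greenForm_isSymm.eq _ _).symm.trans (h d.1 hd)
  have hQ' : Module.finrank ℚ (((greenForm C).restrict V).orthogonal P) =
      Module.finrank ℚ (E.primGrade hc γ) :=
    hQ ▸ (Submodule.comapSubtypeEquivOfLe inf_le_right).finrank_eq
  rw [← hP, ← hQ', LinearMap.BilinForm.finrank_orthogonal
    (greenForm_restrict_nondegenerate hp.homFinite γ)]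
  exact Nat.sub_add_cancel P.finrank_le

/-! ### Decomposables and indecomposables span each nonzero degree. -/

/-- Every class of nonzero degree is decomposable modulo the indecomposable objects. -/
theorem basisVec_mem_sup (hf : E.Finitary) {γ : E.GrothendieckMonoid} (hγ : γ ≠ 0) (X : C)
    (hX : IsoClass.mk X ∈ E.isoGrade γ) :
    basisVec (IsoClass.mk X) ∈ E.decomposablesGrade hf γ ⊔ E.indSpan γ := by
  classical
  have hE := hf.homFinite
  -- The number of endomorphisms replaces any notion of length; it drops when a direct sum is
  -- replaced by a non-split extension of its summands.
  induction hn : Nat.card (X ⟶ X) using Nat.strong_induction_on generalizing X with | h n ih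
  by_cases hi : Indecomposable X
  · exact Submodule.mem_sup_right (Submodule.subset_span ⟨_, ⟨hX, X, rfl, hi⟩, rfl⟩)
  have hX0 : ¬IsZero X := fun h => zero_notMem_isoGrade hγ (IsoClass.mk_eq_zero_iff.2 h ▸ hX)
  obtain ⟨A, B, ⟨e⟩, hA, hB⟩ : ∃ A B, Nonempty (X ≅ A ⊞ B) ∧ ¬IsZero A ∧ ¬IsZero B := by
    simp only [Indecomposable, not_and, not_forall, not_or] at hi
    obtain ⟨A, B, e, h⟩ := hi hX0
    exact ⟨A, B, ⟨e⟩, h⟩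
  have hx : IsoClass.mk X = IsoClass.mk A + IsoClass.mk B := IsoClass.mk_eq_iff.2 ⟨e⟩
  set a := IsoClass.mk A
  set b := IsoClass.mk B
  set x := IsoClass.mk X
  have hxe : x ∈ E.ext a b := hx ▸ E.add_mem_ext a b
  have hab : hf.mul (basisVec a) (basisVec b) ∈ E.decomposablesGrade hf γ := by
    refine ⟨?_, ?_⟩
    · rw [hf.decomposables_eq_span]
      exact Submodule.subset_span ⟨a, b, mt IsoClass.mk_eq_zero_iff.1 hA,
        mt IsoClass.mk_eq_zero_iff.1 hB, rfl⟩
    · have := hf.mul_basisVec_mem_component a b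
      rwa [← hx, show E.grade x = γ from hX] at this
  have hsum : hf.mul (basisVec a) (basisVec b) = E.hallCoeff a b x • basisVec x +
      ∑ y ∈ (hf.finite_ext a b).toFinset.erase x, E.hallCoeff a b y • basisVec y := by
    rw [Finset.add_sum_erase _ (fun y => E.hallCoeff a b y • basisVec y) (by simpa using hxe)]
    simp [Finitary.mul]
  -- The split extension occurs with nonzero coefficient, so `[x]` can be solved for in terms of the
  -- product and the other middle terms.
  rw [← Submodule.smul_mem_iff _ (hallCoeff_ne_zero hE hxe), eq_sub_iff_add_eq.2 hsum.symm]
  refine Submodule.sub_mem _ (Submodule.mem_sup_left hab) (Submodule.sum_mem _ fun y hy => ?_)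
  refine Submodule.smul_mem _ _ ?_
  rw [Finset.mem_erase, Set.Finite.mem_toFinset] at hy
  obtain ⟨hyx, hye⟩ := hy
  have hyγ : y ∈ E.isoGrade γ := (E.grade_of_mem_ext hye).trans (hx ▸ hX)
  obtain ⟨S, hS, h₁, rfl, h₃⟩ := hye
  obtain ⟨e₁⟩ := IsoClass.mk_eq_iff.1 h₁
  obtain ⟨e₃⟩ := IsoClass.mk_eq_iff.1 h₃
  have eX : S.X₃ ⊞ S.X₁ ≅ X := biprod.mapIso e₃ e₁ ≪≫ e.symm
  refine ih _ ?_ S.X₂ hyγ rfl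
  rw [← hn, ← Nat.card_congr (eX.homCongr eX)]
  -- The sequence does not split, since a middle term isomorphic to `A ⊕ B ≅ X` would give `y = x`.
  exact hS.card_end_lt hE ⟨fun e' => hyx (IsoClass.mk_eq_iff.2 ⟨e' ≪≫ eX⟩)⟩

theorem decomposablesGrade_sup_indSpan (hf : E.Finitary) {γ : E.GrothendieckMonoid} (hγ : γ ≠ 0) :
    E.decomposablesGrade hf γ ⊔ E.indSpan γ = E.component γ := by
  refine le_antisymm (sup_le inf_le_right (indSpan_le_component γ)) (Submodule.span_le.2 ?_)
  rintro _ ⟨x, hx, rfl⟩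
  induction x using IsoClass.ind with | h X
  exact basisVec_mem_sup hf hγ X hx

end ExactStructure

end HallAlgebra

/-! ### The dimension count. -/

theorem mainTheorem5 {C : Type u} [Category.{v} C] [Preadditive C] [HasZeroObject C]
    [HasBinaryBiproducts C] (E : ExactStructure C) (hp : E.Profinitary) (hc : E.Cofinitary)
    (γ : E.GrothendieckMonoid) (hγ : γ ≠ 0) :
    (E.indGrade γ).Finite ∧ Module.Finite ℚ (E.component γ) ∧
    E.multiplicity hc γ =
      Module.finrank ℚ ↥(E.decomposablesGrade hp.finitary γ ⊓ E.indSpan γ) ∧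
    0 ≤ E.multiplicity hc γ ∧
    ((∀ x ∈ E.indGrade γ, basisVec x ∈ E.decomposablesGrade hp.finitary γ) →
      E.primGrade hc γ = ⊥) := by
  have hfin : Module.Finite ℚ (E.component γ) :=
    Module.Finite.span_of_finite ℚ ((hp.finite_isoGrade γ).image _)
  have : Module.Finite ℚ (E.indSpan γ) :=
    Submodule.finiteDimensional_of_le (ExactStructure.indSpan_le_component γ)
  have : Module.Finite ℚ (E.decomposablesGrade hp.finitary γ) :=
    Submodule.finiteDimensional_of_le inf_le_right
  have : Module.Finite ℚ (E.primGrade hc γ) := Submodule.finiteDimensional_of_le inf_le_right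
  have hdim := ExactStructure.finrank_primGrade_add hp hc hγ
  have hsup := Submodule.finrank_sup_add_finrank_inf_eq
    (E.decomposablesGrade hp.finitary γ) (E.indSpan γ)
  rw [ExactStructure.decomposablesGrade_sup_indSpan hp.finitary hγ] at hsup
  have hind : Module.finrank ℚ (E.indSpan γ) = (E.indGrade γ).ncard := finrank_span_basisVec _
  have hm : E.multiplicity hc γ =
      Module.finrank ℚ ↥(E.decomposablesGrade hp.finitary γ ⊓ E.indSpan γ) := by
    rw [ExactStructure.multiplicity]
    omega
  refine ⟨(hp.finite_isoGrade γ).subset fun _ hx => hx.1, hfin, hm, by omega, fun h => ?_⟩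
  have hle : E.indSpan γ ≤ E.decomposablesGrade hp.finitary γ := by
    refine Submodule.span_le.2 ?_
    rintro _ ⟨x, hx, rfl⟩
    exact h x hx
  -- The intersection is now all of `ℚ Ind_γ`, so the sum formula forces `dim P_γ = dim H_γ`, which
  -- leaves dimension `0` for the primitive elements.
  rw [inf_eq_right.2 hle] at hsup
  exact Submodule.finrank_eq_zero.1 (by omega)
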